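/- Let $k$ and $n$ be positive integers. A *$k$-colored generalized Frobenius symbol* of $n$ is a $2\times d$ array $$\lambda=\begin{pmatrix} c_1(z_1) & c_2(z_2) & \cdots & c_d(z_d)\\ c'_1(z'_1) & c'_2(z'_2) & \cdots & c'_d(z'_d)\end{pmatrix}$$ of nonnegative integers $z_j, z'_j$ with colors $c_j,c'_j\in\{1,\dots,k\}$ such that each row is strictly decreasing from left to right with respect to the order in which colored integers are compared first by the integer and then by the color, and such that $$n=d+\sum_{j=1}^{d}(z_j+z'_j).$$ Let $\sigma_k$ be the $k$-cycle $(1\ 2\ \cdots\ k)$. The *order* of $\lambda$ is the smallest positive integer $\ell$ such that replacing every color $c$ in $\lambda$ by $\sigma_k^{\ell}(c)$ and then sorting each row into strictly decreasing order gives back $\lambda$. Let $\overline{c\phi}_k(n)$ be the (finite) number of $k$-colored generalized Frobenius symbols of $n$ whose order is $k$. Then, for all positive integers $k$ and $n$, $$\overline{c\phi}_k(n)\equiv 0 \pmod{k^2}.$$ -/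

import Mathlib

namespace GenFrob

/-- A colored part: a nonnegative integer `z` with one of `k` colors. The colors `1, …, k` are
represented by the elements `0, …, k - 1` of `Fin k`. The order is lexicographic:
parts are compared first by size and then by color. -/
abbrev ColoredPart (k : ℕ) : Type := ℕ ×ₗ Fin k

/-- The size of a colored part (its color is ignored). -/
def ColoredPart.size {k : ℕ} (e : ColoredPart k) : ℕ := (ofLex e).1

/-- The color of a colored part. -/
def ColoredPart.color {k : ℕ} (e : ColoredPart k) : Fin k := (ofLex e).2

/-- A `k`-colored generalized Frobenius symbol: two rows of colored parts of the same length,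
each of them strictly decreasing from left to right. -/
@[ext]
structure Symbol (k : ℕ) where
  top : List (ColoredPart k)
  bottom : List (ColoredPart k)
  length_eq : top.length = bottom.length
  top_decreasing : top.Pairwise (· > ·)
  bottom_decreasing : bottom.Pairwise (· > ·)

/-- The integer `d + ∑ (z_j + z'_j)` of which the symbol is a symbol, where `d` is the number of
columns. -/
def Symbol.weight {k : ℕ} (s : Symbol k) : ℕ :=
  s.top.length + (s.top.map ColoredPart.size).sum + (s.bottom.map ColoredPart.size).sum

/-- The `ℓ`-th power of the `k`-cycle `(1 2 ⋯ k)` applied to the color of a part. -/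
def ColoredPart.shift {k : ℕ} (ℓ : ℕ) (e : ColoredPart k) : ColoredPart k :=
  toLex (e.size, (finRotate k ^ ℓ) e.color)

/-- Apply the `ℓ`-th power of the cyclic shift of colors to every entry of a row and sort the
result into decreasing order. -/
def shiftRow {k : ℕ} (ℓ : ℕ) (row : List (ColoredPart k)) : List (ColoredPart k) :=
  (row.map (ColoredPart.shift ℓ)).insertionSort (· ≥ ·)

/-- The symbol is unchanged when the colors are shifted `ℓ` times and the rows are sorted. -/
def Symbol.IsFixedByShift {k : ℕ} (s : Symbol k) (ℓ : ℕ) : Prop :=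
  shiftRow ℓ s.top = s.top ∧ shiftRow ℓ s.bottom = s.bottom

/-- `ℓ` is the order of the symbol with respect to the cyclic shift of colors: the smallest
positive integer such that shifting the colors `ℓ` times leaves the symbol unchanged. -/
def Symbol.HasOrder {k : ℕ} (s : Symbol k) (ℓ : ℕ) : Prop :=
  IsLeast {m : ℕ | 0 < m ∧ s.IsFixedByShift m} ℓ

/-- The `k`-colored generalized Frobenius symbols of `n` that have order `ℓ`. -/
def symbolsOfOrder (k ℓ n : ℕ) : Set (Symbol k) :=
  {s | s.weight = n ∧ s.HasOrder ℓ}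

end GenFrob

/-! Recording, for each row and each size, the set of colors that occur turns a symbol into a family
of subsets of `ZMod k`. The cyclic shift of colors becomes translation by 1, and the conditions on
row lengths and weight depend only on the vector `s` of cardinalities. For `k = d * ℓ`, the families
fixed by translation by `ℓ` number `N(ℓ) = ∑ s, ∏ t, invariantChoose d ℓ (s t)`, since an invariant
set is a pullback from `ZMod ℓ`.

Fix a prime `p` with `p ^ a` exactly dividing `k`, and `ℓ = p * A` with `p ^ a ∣ ℓ ∣ k`. Then `N(p *
A) - N(A)` counts the families whose order divides `p * A` but not `A`. All such orders are
multiples of `p ^ a`, so induction on `ℓ` reduces the theorem to `p ^ (2 * a) ∣ N(p * A) - N(A)`,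
which is `prime_pow_dvd_sum_prod_sub`.

Corresponding factors of the two products agree modulo `p ^ a`, so modulo `p ^ (2 * a)` only the
terms linear in their differences remain. A nonzero linear term forces `p` to divide all sizes but
one, hence all of them, because the two rows have equal length. For odd `p` the remaining difference
is `(pA choose pB) - (A choose B)` or zero, and it vanishes modulo `p ^ (2 * a)`. For `p = 2` each
linear term is only divisible by `2 ^ (2 * a - 1)`; exchanging the two rows pairs the terms and
supplies the missing factor 2. -/

/-! ### Congruences between binomial coefficients -/

/-- The binomial coefficients `(pA choose pB)` and `(A choose B)` differ by a quotient of products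
over the residues prime to `p`. -/
theorem choose_mul_mul_prod_eq (p A B : ℕ) (hp : 0 < p) :
    ((p * A).choose (p * B) : ℤ) *
        ∏ i ∈ Finset.range B, ∏ r ∈ Finset.range (p - 1), ((p : ℤ) * i + (r + 1)) =
      (A.choose B : ℤ) *
        ∏ i ∈ Finset.range B, ∏ r ∈ Finset.range (p - 1),
          ((p : ℤ) * A - ((p : ℤ) * i + (r + 1))) := by
  have split : ∀ f : ℕ → ℤ, ∀ m : ℕ, ∏ j ∈ Finset.range (p * m), f j =
      (∏ i ∈ Finset.range m, f (p * i)) *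
        ∏ i ∈ Finset.range m, ∏ r ∈ Finset.range (p - 1), f (p * i + (r + 1)) := by
    intro f m
    induction m with
    | zero => simp
    | succ m ih =>
      rw [Nat.mul_succ, Finset.prod_range_add, ih, Finset.prod_range_succ, Finset.prod_range_succ]
      obtain ⟨p', rfl⟩ : ∃ p', p = p' + 1 := ⟨p - 1, by omega⟩
      rw [Finset.prod_range_succ']
      simp only [add_zero, Nat.add_sub_cancel]
      ring
  have desc : ∀ N m : ℕ, (N.descFactorial m : ℤ) = ∏ j ∈ Finset.range m, ((N : ℤ) - j) := by
    intro N m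
    induction m with
    | zero => simp
    | succ m ih =>
      rw [Nat.descFactorial_succ, Finset.prod_range_succ, ← ih]
      push_cast
      rcases le_or_gt m N with h | h
      · rw [Nat.cast_sub h]; ring
      · rw [Nat.descFactorial_of_lt h]; simp
  have fact : ∀ m : ℕ, (m.factorial : ℤ) = ∏ j ∈ Finset.range m, ((j : ℤ) + 1) := by
    intro m
    rw [← Finset.prod_range_add_one_eq_factorial]
    push_cast
    rfl
  have factp : ((p * B).factorial : ℤ) = (p : ℤ) ^ B * B.factorial *
      ∏ i ∈ Finset.range B, ∏ r ∈ Finset.range (p - 1), ((p : ℤ) * i + (r + 1)) := by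
    induction B with
    | zero => simp
    | succ m ih =>
      obtain ⟨p', rfl⟩ : ∃ p', p = p' + 1 := ⟨p - 1, by omega⟩
      rw [fact, Nat.mul_succ, Finset.prod_range_add, ← fact, ih, Finset.prod_range_succ,
        Finset.prod_range_succ, Nat.factorial_succ]
      simp only [Nat.add_sub_cancel]
      push_cast
      simp only [add_assoc]
      ring
  have h1 : ((p * A).descFactorial (p * B) : ℤ) = (p : ℤ) ^ B * A.descFactorial B *
        ∏ i ∈ Finset.range B, ∏ r ∈ Finset.range (p - 1),
          ((p : ℤ) * A - ((p : ℤ) * i + (r + 1))) := by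
    rw [desc, split, desc]
    push_cast
    congr 1
    simp only [← mul_sub]
    rw [Finset.prod_mul_distrib]
    simp
  rw [Nat.descFactorial_eq_factorial_mul_choose, Nat.descFactorial_eq_factorial_mul_choose] at h1
  push_cast at h1
  rw [factp] at h1
  have h2 : ((p : ℤ) ^ B * B.factorial) ≠ 0 := by positivity
  apply mul_left_cancel₀ h2
  linear_combination h1

/-- Squares of the two products in `choose_mul_mul_prod_eq` agree modulo common divisors of `x ^ 2`
and `x * (p * B)`. -/
theorem sq_prod_sub_sq_prod_dvd (p B : ℕ) (x D : ℤ) (h1 : D ∣ x ^ 2) (h2 : D ∣ x * (p * B)) :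
    D ∣ (∏ i ∈ Finset.range B, ∏ r ∈ Finset.range (p - 1), (x - ((p : ℤ) * i + (r + 1)))) ^ 2 -
      (∏ i ∈ Finset.range B, ∏ r ∈ Finset.range (p - 1), ((p : ℤ) * i + (r + 1))) ^ 2 := by
  -- The reflection `y ↦ p * B - y` permutes the factors. Pairing each factor with its mirror image
  -- helps because `(x - y) * (x - (p * B - y))` differs from `y * (p * B - y)` by `x ^ 2 - x * (p *
  -- B)`.
  have refl : ∀ f : ℤ → ℤ,
      (∏ i ∈ Finset.range B, ∏ r ∈ Finset.range (p - 1), f ((p : ℤ) * i + (r + 1))) ^ 2 =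
      ∏ i ∈ Finset.range B, ∏ r ∈ Finset.range (p - 1),
        (f ((p : ℤ) * i + (r + 1)) * f (p * B - ((p : ℤ) * i + (r + 1)))) := by
    intro f
    simp only [Finset.prod_mul_distrib]
    rw [sq]
    congr 1
    rw [← Finset.prod_range_reflect]
    refine Finset.prod_congr rfl fun i hi => ?_
    rw [← Finset.prod_range_reflect]
    refine Finset.prod_congr rfl fun r hr => ?_
    rw [Finset.mem_range] at hi hr
    congr 1
    have e1 : ((B - 1 - i : ℕ) : ℤ) = B - 1 - i := by omega
    have e2 : ((p - 1 - 1 - r : ℕ) : ℤ) = p - 1 - 1 - r := by omega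
    rw [e1, e2]
    ring
  rw [refl (fun y => x - y), refl (fun y => y)]
  apply Int.ModEq.dvd
  refine Int.ModEq.prod fun i _ => Int.ModEq.prod fun r _ => ?_
  rw [Int.modEq_iff_dvd]
  have h := dvd_sub h1 h2
  refine Dvd.dvd.trans h (dvd_of_eq ?_)
  ring

/-- Reducing the second product of `choose_mul_mul_prod_eq` modulo divisors of `x`. -/
theorem prod_sub_modEq (p B : ℕ) (x D : ℤ) (h : D ∣ x) :
    ∏ i ∈ Finset.range B, ∏ r ∈ Finset.range (p - 1), (x - ((p : ℤ) * i + (r + 1))) ≡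
      (-1) ^ ((p - 1) * B) *
        ∏ i ∈ Finset.range B, ∏ r ∈ Finset.range (p - 1), ((p : ℤ) * i + (r + 1)) [ZMOD D] := by
  have e : (-1) ^ ((p - 1) * B) *
        ∏ i ∈ Finset.range B, ∏ r ∈ Finset.range (p - 1), ((p : ℤ) * i + (r + 1)) =
      ∏ i ∈ Finset.range B, ∏ r ∈ Finset.range (p - 1), (-((p : ℤ) * i + (r + 1))) := by
    simp only [Finset.prod_neg, Finset.card_range]
    rw [Finset.prod_mul_distrib]
    simp [pow_mul]
  rw [e]
  refine Int.ModEq.prod fun i _ => Int.ModEq.prod fun r _ => ?_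
  apply Int.ModEq.symm
  rw [Int.modEq_iff_dvd]
  convert h using 2
  ring

theorem not_dvd_prod_units {p : ℕ} (hp : p.Prime) (B : ℕ) :
    ¬ (p : ℤ) ∣ ∏ i ∈ Finset.range B, ∏ r ∈ Finset.range (p - 1), ((p : ℤ) * i + (r + 1)) := by
  have hp' := Nat.prime_iff_prime_int.mp hp
  intro h
  obtain ⟨i, -, h⟩ := (hp'.dvd_finsetProd_iff _).mp h
  obtain ⟨r, hr, h⟩ := (hp'.dvd_finsetProd_iff _).mp h
  rw [Finset.mem_range] at hr
  have h3 : (p : ℤ) ∣ ((r + 1 : ℕ) : ℤ) := by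
    have := dvd_sub h (Dvd.intro (i : ℤ) rfl)
    push_cast
    simpa using this
  have := Nat.le_of_dvd (Nat.succ_pos _) (Int.natCast_dvd_natCast.mp h3)
  omega

/-- Absorption: `s * N.choose s = N * (N - 1).choose (s - 1)` for positive `s` and `N`. -/
theorem dvd_mul_choose {m N s : ℕ} (h : m ∣ N) : m ∣ s * N.choose s := by
  rcases s with _ | s
  · simp
  rcases N with _ | N
  · simp
  rw [mul_comm, ← Nat.add_one_mul_choose_eq]
  exact h.mul_right _

theorem prime_pow_dvd_choose_of_not_dvd {p a N s : ℕ} (hp : p.Prime) (h : p ^ a ∣ N)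
    (hs : ¬ p ∣ s) : p ^ a ∣ N.choose s :=
  (Nat.Coprime.pow_left a ((Nat.Prime.coprime_iff_not_dvd hp).mpr hs)).dvd_of_dvd_mul_left
    (dvd_mul_choose h)

/-- The first-order congruence between `(pA choose pB)` and `(A choose B)`. -/
theorem prime_pow_dvd_choose_sub {p a A B : ℕ} (hp : p.Prime) (h : p ^ a ∣ p * A) :
    (p : ℤ) ^ a ∣ ((p * A).choose (p * B) : ℤ) - A.choose B := by
  have hp' := Nat.prime_iff_prime_int.mp hp
  have key := choose_mul_mul_prod_eq p A B hp.pos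
  have hU := not_dvd_prod_units hp B
  have hx : (p : ℤ) ^ a ∣ (p : ℤ) * A := by exact_mod_cast h
  have hV := (prod_sub_modEq p B _ _ hx).symm.dvd
  set U := ∏ i ∈ Finset.range B, ∏ r ∈ Finset.range (p - 1), ((p : ℤ) * i + (r + 1)) with hUdef
  set V := ∏ i ∈ Finset.range B, ∏ r ∈ Finset.range (p - 1),
          ((p : ℤ) * A - ((p : ℤ) * i + (r + 1))) with hVdef
  apply hp'.pow_dvd_of_dvd_mul_right a hU
  have e : (((p * A).choose (p * B) : ℤ) - A.choose B) * U = A.choose B * (V - U) := by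
    linear_combination key
  rw [e]
  rcases Nat.even_or_odd ((p - 1) * B) with he | ho
  · rw [he.neg_one_pow, one_mul] at hV
    exact hV.mul_left _
  -- The sign is negative only for `p = 2` and odd `B`. Then `V ≡ -U`, and the error `2 * U` is
  -- harmless because `A.choose B` is divisible by `2 ^ (a - 1)`.
  · rw [Nat.odd_mul] at ho
    obtain rfl : p = 2 := by
      rcases hp.eq_two_or_odd' with h2 | h2
      · exact h2
      · exact absurd ho.1 (by rw [Nat.not_odd_iff_even]; exact h2.tsub_odd odd_one)
    rw [(show Odd ((2 - 1) * B) by simpa using ho.2).neg_one_pow] at hV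
    rcases a with _ | a
    · simp
    have hA : 2 ^ a ∣ A := by
      rw [pow_succ'] at h
      exact Nat.dvd_of_mul_dvd_mul_left two_pos h
    have hC : (2 : ℤ) ^ a ∣ A.choose B := by
      exact_mod_cast prime_pow_dvd_choose_of_not_dvd Nat.prime_two hA
        (by have := ho.2; rwa [← even_iff_two_dvd, Nat.not_even_iff_odd])
    have e2 : (A.choose B : ℤ) * (V - U) = A.choose B * (V - -1 * U) - A.choose B * 2 * U := by
      ring
    rw [e2]
    refine dvd_sub (hV.mul_left _) (Dvd.dvd.mul_right ?_ _)
    rw [pow_succ]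
    exact mul_dvd_mul hC (by simp)

/-- A common source of the second-order congruences: divisibility of the difference of the squared
products, together with the complementary divisibility of `(A choose B)`. -/
theorem exists_pow_dvd_sq_sub_and_dvd_choose {p a A B : ℕ} (hp : p.Prime) (h : p ^ a ∣ p * A)
    (ha : 0 < a) :
    ∃ c, 0 < c ∧ c ≤ a ∧ p ^ (a - c) ∣ A.choose B ∧
      (p : ℤ) ^ (a + c) ∣
        (∏ i ∈ Finset.range B, ∏ r ∈ Finset.range (p - 1),
          ((p : ℤ) * A - ((p : ℤ) * i + (r + 1)))) ^ 2 -
        (∏ i ∈ Finset.range B, ∏ r ∈ Finset.range (p - 1), ((p : ℤ) * i + (r + 1))) ^ 2 := by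
  have hx : (p : ℤ) ^ a ∣ (p : ℤ) * A := by exact_mod_cast h
  -- The witness `c` is the `p`-adic valuation of `p * B`, capped at `a`.
  suffices hc : ∃ c, 0 < c ∧ c ≤ a ∧ p ^ (a - c) ∣ A.choose B ∧ p ^ c ∣ p * B by
    obtain ⟨c, h0, h1, h2, h3⟩ := hc
    refine ⟨c, h0, h1, h2, sq_prod_sub_sq_prod_dvd p B _ _ ?_ ?_⟩
    · rw [sq]
      refine (pow_dvd_pow _ (Nat.add_le_add_left h1 a)).trans ?_
      rw [pow_add]
      exact mul_dvd_mul hx hx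
    · rw [pow_add]
      exact mul_dvd_mul hx (by exact_mod_cast h3)
  by_cases hB : p ^ a ∣ p * B
  · exact ⟨a, ha, le_rfl, by simp, hB⟩
  have hB0 : p * B ≠ 0 := by rintro h0; simp [h0] at hB
  obtain ⟨c, u, hu, e⟩ := Nat.exists_eq_pow_mul_and_not_dvd hB0 p hp.ne_one
  have hca : c < a := by
    by_contra hlt
    exact hB (e ▸ (pow_dvd_pow p (not_lt.mp hlt)).mul_right u)
  have hc0 : 0 < c := by
    rcases Nat.eq_zero_or_pos c with rfl | h0
    · rw [pow_zero, one_mul] at e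
      exact absurd (Dvd.intro _ e) hu
    · exact h0
  refine ⟨c, hc0, hca.le, ?_, e ▸ Dvd.intro _ rfl⟩
  obtain ⟨a', rfl⟩ : ∃ a', a = a' + 1 := ⟨a - 1, by omega⟩
  have hA : p ^ a' ∣ A := by
    rw [pow_succ'] at h
    exact Nat.dvd_of_mul_dvd_mul_left hp.pos h
  have h2 : p ^ (a' + 1) ∣ p ^ c * (u * A.choose B) := by
    rw [← mul_assoc, ← e, mul_assoc, pow_succ']
    exact mul_dvd_mul_left p (dvd_mul_choose hA)
  have h3 : p ^ (a' + 1) = p ^ c * p ^ (a' + 1 - c) := by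
    rw [← pow_add]; congr 1; omega
  rw [h3] at h2
  have h4 := Nat.dvd_of_mul_dvd_mul_left (pow_pos hp.pos c) h2
  exact (Nat.Coprime.pow_left _ ((Nat.Prime.coprime_iff_not_dvd hp).mpr hu)).dvd_of_dvd_mul_left h4

/-- The second-order congruence between `(pA choose pB)` and `(A choose B)` for odd `p`. -/
theorem odd_prime_pow_two_mul_dvd_choose_sub {p a A B : ℕ} (hp : p.Prime) (hp2 : p ≠ 2)
    (h : p ^ a ∣ p * A) :
    (p : ℤ) ^ (2 * a) ∣ ((p * A).choose (p * B) : ℤ) - A.choose B := by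
  rcases Nat.eq_zero_or_pos a with rfl | ha
  · simp
  have hp' := Nat.prime_iff_prime_int.mp hp
  have key := choose_mul_mul_prod_eq p A B hp.pos
  have hU := not_dvd_prod_units hp B
  have hV := (prod_sub_modEq p B _ _ (Dvd.intro (A : ℤ) rfl : (p : ℤ) ∣ p * A)).symm.dvd
  obtain ⟨c, -, hca, hC, hsq⟩ := exists_pow_dvd_sq_sub_and_dvd_choose (B := B) hp h ha
  set U := ∏ i ∈ Finset.range B, ∏ r ∈ Finset.range (p - 1), ((p : ℤ) * i + (r + 1)) with hUdef
  set V := ∏ i ∈ Finset.range B, ∏ r ∈ Finset.range (p - 1),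
          ((p : ℤ) * A - ((p : ℤ) * i + (r + 1))) with hVdef
  apply hp'.pow_dvd_of_dvd_mul_right _ hU
  have e : (((p * A).choose (p * B) : ℤ) - A.choose B) * U = A.choose B * (V - U) := by
    linear_combination key
  rw [e]
  have hodd := hp.odd_of_ne_two hp2
  rw [((hodd.tsub_odd odd_one).mul_right B).neg_one_pow, one_mul] at hV
  -- Since `V ≡ U` modulo `p`, the sum `V + U ≡ 2 * U` is prime to `p` and can be cancelled from `V
  -- ^ 2 - U ^ 2`.
  have hsum : ¬ (p : ℤ) ∣ V + U := by
    intro hd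
    have h2 : (p : ℤ) ∣ 2 * U := by
      have := dvd_sub hd hV
      refine Dvd.dvd.trans this (dvd_of_eq ?_)
      ring
    rcases hp'.dvd_or_dvd h2 with h3 | h3
    · have : p ∣ 2 := by exact_mod_cast h3
      exact hp2 ((Nat.prime_dvd_prime_iff_eq hp Nat.prime_two).mp this)
    · exact hU h3
  have hd : (p : ℤ) ^ (a + c) ∣ V - U := by
    apply hp'.pow_dvd_of_dvd_mul_right _ hsum
    refine Dvd.dvd.trans hsq (dvd_of_eq ?_)
    ring
  have e3 : 2 * a = (a - c) + (a + c) := by omega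
  rw [e3, pow_add]
  exact mul_dvd_mul (by exact_mod_cast hC) hd

/-- The second-order congruence between `(2A choose 2B)` and `(A choose B)` for even `B`. -/
theorem two_pow_dvd_choose_sub {a A B : ℕ} (h : 2 ^ a ∣ 2 * A) (hB : Even B) :
    (2 : ℤ) ^ (2 * a - 1) ∣ ((2 * A).choose (2 * B) : ℤ) - A.choose B := by
  rcases Nat.lt_or_ge a 2 with ha | ha
  · refine (pow_dvd_pow 2 (show 2 * a - 1 ≤ a by omega)).trans ?_
    exact prime_pow_dvd_choose_sub Nat.prime_two h
  have hp' := Int.prime_two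
  have key := choose_mul_mul_prod_eq 2 A B two_pos
  have hU := not_dvd_prod_units Nat.prime_two B
  have h4 : (4 : ℤ) ∣ (2 : ℕ) * A := by
    have : 4 ∣ 2 * A := (pow_dvd_pow 2 ha).trans h
    exact_mod_cast this
  have hV := (prod_sub_modEq 2 B _ _ h4).symm.dvd
  obtain ⟨c, hc0, hca, hC, hsq⟩ :=
    exists_pow_dvd_sq_sub_and_dvd_choose (B := B) Nat.prime_two h (by omega)
  set U := ∏ i ∈ Finset.range B, ∏ r ∈ Finset.range (2 - 1), (((2 : ℕ) : ℤ) * i + (r + 1))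
    with hUdef
  set V := ∏ i ∈ Finset.range B, ∏ r ∈ Finset.range (2 - 1),
          (((2 : ℕ) : ℤ) * A - (((2 : ℕ) : ℤ) * i + (r + 1))) with hVdef
  apply hp'.pow_dvd_of_dvd_mul_right _ hU
  have e : (((2 * A).choose (2 * B) : ℤ) - A.choose B) * U = A.choose B * (V - U) := by
    linear_combination key
  rw [e]
  rw [(hB.mul_left (2 - 1)).neg_one_pow, one_mul] at hV
  obtain ⟨m, hm⟩ := hV
  -- Here `V + U = 2 * (U + 2 * m)` with `U` odd, so passing from `V ^ 2 - U ^ 2` to `V - U` costs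
  -- exactly one factor 2.
  have hsum : ¬ (2 : ℤ) ∣ U + 2 * m := by
    intro hd
    apply hU
    have := dvd_sub hd (Dvd.intro m rfl)
    simpa using this
  have hd : (2 : ℤ) ^ (a + c - 1) ∣ V - U := by
    apply hp'.pow_dvd_of_dvd_mul_right _ hsum
    have e2 : V ^ 2 - U ^ 2 = 2 * ((V - U) * (U + 2 * m)) := by
      linear_combination (V - U) * hm
    rw [e2, show a + c = (a + c - 1) + 1 by omega, pow_succ'] at hsq
    exact Int.dvd_of_mul_dvd_mul_left two_ne_zero hsq
  have e3 : 2 * a - 1 = (a - c) + (a + c - 1) := by omega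
  rw [e3, pow_add]
  exact mul_dvd_mul (by exact_mod_cast hC) hd

/-- A product of perturbed factors, to second order in the perturbation. -/
theorem sq_dvd_prod_sub_prod_sub_sum {ι : Type*} [DecidableEq ι] (T : Finset ι) (f g : ι → ℤ)
    (q : ℤ) (h : ∀ t ∈ T, q ∣ f t - g t) :
    q ^ 2 ∣ ∏ t ∈ T, f t - ∏ t ∈ T, g t - ∑ t ∈ T, (f t - g t) * ∏ u ∈ T.erase t, g u := by
  induction T using Finset.induction_on with
  | empty => simp
  | insert b T hb ih =>
    have ih := ih fun t ht => h t (Finset.mem_insert_of_mem ht)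
    have hsum : q ∣ ∑ t ∈ T, (f t - g t) * ∏ u ∈ T.erase t, g u :=
      Finset.dvd_sum fun t ht => (h t (Finset.mem_insert_of_mem ht)).mul_right _
    have e : ∑ t ∈ T, (f t - g t) * ∏ u ∈ (insert b T).erase t, g u =
        g b * ∑ t ∈ T, (f t - g t) * ∏ u ∈ T.erase t, g u := by
      rw [Finset.mul_sum]
      refine Finset.sum_congr rfl fun t ht => ?_
      have htb : b ≠ t := by rintro rfl; exact hb ht
      rw [Finset.erase_insert_of_ne htb, Finset.prod_insert (by simp [hb])]
      ring
    rw [Finset.prod_insert hb, Finset.prod_insert hb, Finset.sum_insert hb, e,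
      Finset.erase_insert hb]
    have h1 := (ih.mul_left (f b))
    have h2 := mul_dvd_mul (h b (Finset.mem_insert_self _ _)) hsum
    rw [← sq] at h2
    refine (dvd_add h1 h2).trans (dvd_of_eq ?_)
    ring

/-! ### Congruences for numbers of invariant sets -/

/-- The number of sets of `s` residues modulo `d * ℓ` that are invariant under the shift by `ℓ`. -/
def invariantChoose (d ℓ s : ℕ) : ℕ := if d ∣ s then ℓ.choose (s / d) else 0

theorem invariantChoose_of_not_dvd {d ℓ s : ℕ} (h : ¬ d ∣ s) : invariantChoose d ℓ s = 0 := if_neg h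

theorem invariantChoose_mul {d : ℕ} (hd : 0 < d) (ℓ m : ℕ) :
    invariantChoose d ℓ (d * m) = ℓ.choose m := by
  simp [invariantChoose, Nat.mul_div_cancel_left _ hd]

section

variable {p a d A : ℕ}

theorem prime_pow_dvd_invariantChoose_sub (hp : p.Prime) (hd : 0 < d) (h : p ^ a ∣ p * A) (s : ℕ) :
    (p : ℤ) ^ a ∣ (invariantChoose d (p * A) s : ℤ) - invariantChoose (p * d) A s := by
  by_cases h1 : d ∣ s
  · obtain ⟨m, rfl⟩ := h1
    rw [invariantChoose_mul hd]
    by_cases h2 : p ∣ m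
    · obtain ⟨m, rfl⟩ := h2
      rw [show d * (p * m) = p * d * m by ring, invariantChoose_mul (Nat.mul_pos hp.pos hd)]
      exact prime_pow_dvd_choose_sub hp h
    · rw [invariantChoose_of_not_dvd (d := p * d)]
      · simpa using Int.natCast_dvd_natCast.mpr (prime_pow_dvd_choose_of_not_dvd hp h h2)
      · rw [mul_comm p d]
        exact fun h3 => h2 (Nat.dvd_of_mul_dvd_mul_left hd h3)
  · rw [invariantChoose_of_not_dvd h1, invariantChoose_of_not_dvd]
    · simp
    · exact fun h2 => h1 ((Dvd.intro_left _ rfl).trans h2)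

theorem odd_prime_pow_two_mul_dvd_invariantChoose_sub (hp : p.Prime) (hp2 : p ≠ 2) (hd : ¬ p ∣ d)
    (h : p ^ a ∣ p * A) {s : ℕ} (hs : p ∣ s) :
    (p : ℤ) ^ (2 * a) ∣ (invariantChoose d (p * A) s : ℤ) - invariantChoose (p * d) A s := by
  have hd0 : 0 < d := Nat.pos_of_ne_zero (by rintro rfl; simp at hd)
  by_cases h1 : d ∣ s
  · obtain ⟨m, rfl⟩ := h1
    obtain ⟨m, rfl⟩ := (hp.dvd_mul.mp hs).resolve_left hd
    rw [invariantChoose_mul hd0, show d * (p * m) = p * d * m by ring,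
      invariantChoose_mul (Nat.mul_pos hp.pos hd0)]
    exact odd_prime_pow_two_mul_dvd_choose_sub hp hp2 h
  · rw [invariantChoose_of_not_dvd h1, invariantChoose_of_not_dvd]
    · simp
    · exact fun h2 => h1 ((Dvd.intro_left _ rfl).trans h2)

theorem two_pow_dvd_invariantChoose_sub (hd : ¬ 2 ∣ d) (h : 2 ^ a ∣ 2 * A) {s : ℕ} (hs : 4 ∣ s) :
    (2 : ℤ) ^ (2 * a - 1) ∣ (invariantChoose d (2 * A) s : ℤ) - invariantChoose (2 * d) A s := by
  have hd0 : 0 < d := Nat.pos_of_ne_zero (by rintro rfl; simp at hd)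
  by_cases h1 : d ∣ s
  · obtain ⟨m, rfl⟩ := h1
    have hc : Nat.Coprime 4 d :=
      Nat.Coprime.pow_left 2 ((Nat.Prime.coprime_iff_not_dvd Nat.prime_two).mpr hd)
    obtain ⟨m, rfl⟩ := hc.dvd_of_dvd_mul_left hs
    rw [invariantChoose_mul hd0, show d * (4 * m) = 2 * d * (2 * m) by ring,
      invariantChoose_mul (Nat.mul_pos two_pos hd0), show 4 * m = 2 * (2 * m) by ring]
    exact two_pow_dvd_choose_sub h (even_two_mul m)
  · rw [invariantChoose_of_not_dvd h1, invariantChoose_of_not_dvd]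
    · simp
    · exact fun h2 => h1 ((Dvd.intro_left _ rfl).trans h2)

/-- If `s = 2 * d * m` and `4 ∤ s`, then `m` is odd, so `A.choose m` inherits the full power of 2
known to divide `A`. -/
theorem two_pow_dvd_invariantChoose (hd : 0 < d) (h : 2 ^ a ∣ 2 * A) {s : ℕ} (hs : ¬ 4 ∣ s) :
    2 ^ (a - 1) ∣ invariantChoose (2 * d) A s := by
  by_cases h1 : 2 * d ∣ s
  · obtain ⟨m, rfl⟩ := h1
    rw [invariantChoose_mul (Nat.mul_pos two_pos hd)]
    apply prime_pow_dvd_choose_of_not_dvd Nat.prime_two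
    · rcases a with _ | a
      · simp
      · rw [pow_succ'] at h
        exact Nat.dvd_of_mul_dvd_mul_left two_pos h
    · rintro ⟨j, rfl⟩
      exact hs ⟨d * j, by ring⟩
  · rw [invariantChoose_of_not_dvd h1]
    exact dvd_zero _

end

/-! ### Balanced size vectors and linear terms -/

/-- A vector of layer sizes is balanced if top and bottom rows have the same length. -/
def IsBalanced {I : Type*} [Fintype I] (s : Bool × I → ℕ) : Prop :=
  ∑ i, s (true, i) = ∑ i, s (false, i)

section

variable {I : Type*} [Fintype I]

/-- The size at `t` is the total of the opposite row minus the other sizes in its own row. -/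
theorem IsBalanced.dvd {s : Bool × I → ℕ} (hs : IsBalanced s) {m : ℕ} (t : Bool × I)
    (h : ∀ u, u ≠ t → m ∣ s u) : m ∣ s t := by
  classical
  obtain ⟨b, i⟩ := t
  have e : ∑ j, s (b, j) = ∑ j, s (!b, j) := by
    cases b
    · exact hs.symm
    · exact hs
  have h1 : m ∣ ∑ j, s (!b, j) := Finset.dvd_sum fun j _ => h _ (by simp)
  rw [← e, ← Finset.add_sum_erase _ _ (Finset.mem_univ i)] at h1
  refine (Nat.dvd_add_left (Finset.dvd_sum fun j hj => h _ ?_)).mp h1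
  simpa using Finset.ne_of_mem_erase hj

variable [DecidableEq I]

/-- The linear term of the difference between the products of `f` and of `g` over all layers. -/
def linearTerm (f g : ℕ → ℤ) (s : Bool × I → ℕ) (t : Bool × I) : ℤ :=
  (f (s t) - g (s t)) * ∏ u ∈ Finset.univ.erase t, g (s u)

variable {p a d A : ℕ}

theorem dvd_of_linearTerm_ne_zero {s : Bool × I → ℕ} (hs : IsBalanced s)
    (t : Bool × I) (f : ℕ → ℤ)
    (h : linearTerm f (fun m => invariantChoose (p * d) A m) s t ≠ 0) (u : Bool × I) : p ∣ s u := by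
  have h1 : ∀ u, u ≠ t → p ∣ s u := by
    intro u hu
    by_contra hpu
    apply h
    rw [linearTerm, Finset.prod_eq_zero (i := u), mul_zero]
    · simp [hu]
    · rw [invariantChoose_of_not_dvd, Nat.cast_zero]
      exact fun h2 => hpu ((Dvd.intro _ rfl).trans h2)
  by_cases hu : u = t
  · subst hu
    exact hs.dvd u h1
  · exact h1 u hu

theorem odd_prime_pow_dvd_linearTerm (hp : p.Prime) (hp2 : p ≠ 2) (hd : ¬ p ∣ d)
    (h : p ^ a ∣ p * A) {s : Bool × I → ℕ} (hs : IsBalanced s) (t : Bool × I) :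
    (p : ℤ) ^ (2 * a) ∣ linearTerm (fun m => invariantChoose d (p * A) m)
      (fun m => invariantChoose (p * d) A m) s t := by
  by_cases h0 : linearTerm (fun m => (invariantChoose d (p * A) m : ℤ))
      (fun m => invariantChoose (p * d) A m) s t = 0
  · rw [h0]; exact dvd_zero _
  · exact (odd_prime_pow_two_mul_dvd_invariantChoose_sub hp hp2 hd h
      (dvd_of_linearTerm_ne_zero hs t _ h0 t)).mul_right _

/-- If `4 ∣ s t`, the second-order congruence applies directly. Otherwise balance yields another
layer `u` with `4 ∤ s u`; its factor contributes `2 ^ (a - 1)` and the difference at `t` contributes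
`2 ^ a`. -/
theorem two_pow_dvd_linearTerm (ha : 0 < a) (hd : ¬ 2 ∣ d)
    (h : 2 ^ a ∣ 2 * A) {s : Bool × I → ℕ} (hs : IsBalanced s) (t : Bool × I) :
    (2 : ℤ) ^ (2 * a - 1) ∣ linearTerm (fun m => invariantChoose d (2 * A) m)
      (fun m => invariantChoose (2 * d) A m) s t := by
  have hd0 : 0 < d := Nat.pos_of_ne_zero (by rintro rfl; simp at hd)
  by_cases h4 : 4 ∣ s t
  · exact (two_pow_dvd_invariantChoose_sub hd h h4).mul_right _
  · obtain ⟨u, hut, hu⟩ : ∃ u, u ≠ t ∧ ¬ 4 ∣ s u := by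
      by_contra! hcon
      exact h4 (hs.dvd t hcon)
    rw [show 2 * a - 1 = a + (a - 1) by omega, pow_add]
    refine mul_dvd_mul (prime_pow_dvd_invariantChoose_sub Nat.prime_two hd0 h _) ?_
    refine Dvd.dvd.trans ?_ (Finset.dvd_prod_of_mem _ (show u ∈ Finset.univ.erase t by simp [hut]))
    simpa using Int.natCast_dvd_natCast.mpr (two_pow_dvd_invariantChoose hd0 h hu)

/-- Exchange of the two rows. -/
def rowSwap (I : Type*) : Bool × I ≃ Bool × I := Equiv.boolNot.prodCongr (Equiv.refl I)

theorem linearTerm_rowSwap (f g : ℕ → ℤ) (s : Bool × I → ℕ) (t : Bool × I) :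
    linearTerm f g (s ∘ rowSwap I) t = linearTerm f g s (rowSwap I t) := by
  unfold linearTerm
  congr 1
  refine Finset.prod_equiv (rowSwap I) ?_ ?_
  · intro u
    simp
  · intro u _
    rfl

/-- The key congruence: for balanced size vectors the numbers of configurations invariant under the
shifts by `pA` and by `A` agree modulo `p ^ (2 * a)`. -/
theorem prime_pow_dvd_sum_prod_sub (hp : p.Prime) (ha : 0 < a) (hd : ¬ p ∣ d)
    (h : p ^ a ∣ p * A) (P : Finset (Bool × I → ℕ)) (hP : ∀ s ∈ P, IsBalanced s)
    (hswap : ∀ s, s ∘ rowSwap I ∈ P ↔ s ∈ P) :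
    (p : ℤ) ^ (2 * a) ∣ ∑ s ∈ P, ∏ t, (invariantChoose d (p * A) (s t) : ℤ) -
      ∑ s ∈ P, ∏ t, (invariantChoose (p * d) A (s t) : ℤ) := by
  have hd0 : 0 < d := Nat.pos_of_ne_zero (by rintro rfl; simp at hd)
  set f : ℕ → ℤ := fun m => invariantChoose d (p * A) m with hf
  set g : ℕ → ℤ := fun m => invariantChoose (p * d) A m with hg
  have h1 : (p : ℤ) ^ (2 * a) ∣ ∑ s ∈ P, (∏ t, f (s t) - ∏ t, g (s t) - ∑ t, linearTerm f g s t) := by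
    refine Finset.dvd_sum fun s _ => ?_
    rw [mul_comm 2 a, pow_mul]
    exact sq_dvd_prod_sub_prod_sub_sum Finset.univ (fun t => f (s t)) (fun t => g (s t)) _
      fun t _ => prime_pow_dvd_invariantChoose_sub hp hd0 h _
  rw [Finset.sum_sub_distrib, Finset.sum_sub_distrib] at h1
  refine (dvd_sub_left ?_).mp h1
  by_cases hp2 : p = 2
  · subst hp2
    -- Exchanging the rows permutes `P`, so both rows contribute equally and the total is twice one
    -- of them.
    have e : ∑ s ∈ P, ∑ i, linearTerm f g s (false, i) =
        ∑ s ∈ P, ∑ i, linearTerm f g s (true, i) := by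
      refine Finset.sum_nbij' (fun s => s ∘ rowSwap I) (fun s => s ∘ rowSwap I) ?_ ?_ ?_ ?_ ?_
      · intro s hs; exact (hswap s).mpr hs
      · intro s hs; exact (hswap s).mpr hs
      · intro s _; funext ⟨b, i⟩; cases b <;> rfl
      · intro s _; funext ⟨b, i⟩; cases b <;> rfl
      · intro s _
        refine Finset.sum_congr rfl fun i _ => ?_
        rw [linearTerm_rowSwap]
        rfl
    simp only [Fintype.sum_prod_type, Fintype.sum_bool]
    rw [Finset.sum_add_distrib, e, ← two_mul, show 2 * a = (2 * a - 1) + 1 by omega, pow_succ']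
    refine mul_dvd_mul (dvd_refl _) ?_
    exact Finset.dvd_sum fun s hs => Finset.dvd_sum fun i _ =>
      two_pow_dvd_linearTerm ha hd h (hP s hs) _
  · exact Finset.dvd_sum fun s hs => Finset.dvd_sum fun t _ =>
      odd_prime_pow_dvd_linearTerm hp hp2 hd h (hP s hs) t

end

/-! ### Shift-invariant families of sets of residues -/

/-- Invariance of a set of residues under the shift by `ℓ`. -/
def IsShiftInvariant {k : ℕ} (ℓ : ℕ) (S : Finset (ZMod k)) : Prop :=
  ∀ x, x + (ℓ : ZMod k) ∈ S ↔ x ∈ S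

namespace IsShiftInvariant

variable {k : ℕ} {S : Finset (ZMod k)}

theorem self : IsShiftInvariant k S := fun x => by simp

theorem zero : IsShiftInvariant 0 S := fun x => by simp

theorem add {a b : ℕ} (ha : IsShiftInvariant a S) (hb : IsShiftInvariant b S) :
    IsShiftInvariant (a + b) S := fun x => by
  rw [Nat.cast_add, ← add_assoc, hb, ha]

theorem mul {a : ℕ} (ha : IsShiftInvariant a S) (j : ℕ) : IsShiftInvariant (a * j) S := by
  induction j with
  | zero => exact zero
  | succ j ih => rw [Nat.mul_succ]; exact ih.add ha

theorem of_add {a b : ℕ} (ha : IsShiftInvariant a S) (hab : IsShiftInvariant (a + b) S) :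
    IsShiftInvariant b S := fun x => by
  rw [← ha, add_assoc, ← Nat.cast_add, add_comm b a, hab]

theorem of_dvd {a b : ℕ} (ha : IsShiftInvariant a S) (h : a ∣ b) : IsShiftInvariant b S := by
  obtain ⟨j, rfl⟩ := h
  exact ha.mul j

end IsShiftInvariant

theorem card_castHom_fiber {k ℓ d : ℕ} [NeZero k] (h : k = d * ℓ) (y : ZMod ℓ) :
    (Finset.univ.filter fun x : ZMod k =>
      ZMod.castHom (Dvd.intro_left d h.symm) (ZMod ℓ) x = y).card = d := by
  have : NeZero ℓ := ⟨by rintro rfl; exact NeZero.ne k (by simpa using h)⟩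
  set φ := ZMod.castHom (Dvd.intro_left d h.symm) (ZMod ℓ) with hφ
  have hsurj : Function.Surjective φ := ZMod.castHom_surjective _
  have h1 : ∀ z : ZMod ℓ, (Finset.univ.filter fun x : ZMod k => φ x = z).card =
      (Finset.univ.filter fun x : ZMod k => φ x = y).card := fun z =>
    AddMonoidHom.card_fiber_eq_of_mem_range φ.toAddMonoidHom (hsurj z) (hsurj y)
  have h2 := Finset.card_eq_sum_card_fiberwise (f := φ) (s := Finset.univ) (t := Finset.univ)
    (fun _ _ => Finset.mem_coe.mpr (Finset.mem_univ _))
  rw [Finset.sum_congr rfl fun z _ => h1 z, Finset.sum_const, Finset.card_univ, Finset.card_univ,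
    ZMod.card, ZMod.card, smul_eq_mul] at h2
  exact (Nat.eq_of_mul_eq_mul_left (Nat.pos_of_ne_zero (NeZero.ne ℓ))
    ((mul_comm ℓ d).trans (h.symm.trans h2))).symm

-- The invariant sets are exactly the preimages of subsets of `ZMod ℓ` under reduction, and each
-- preimage is `d` times as large as the subset.
open scoped Classical in
theorem card_isShiftInvariant {k ℓ d : ℕ} [NeZero k] (h : k = d * ℓ) (s : ℕ) :
    (Finset.univ.filter fun S : Finset (ZMod k) => S.card = s ∧ IsShiftInvariant ℓ S).card =
      invariantChoose d ℓ s := by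
  have : NeZero ℓ := ⟨by rintro rfl; exact NeZero.ne k (by simpa using h)⟩
  have hd0 : 0 < d := Nat.pos_of_ne_zero (by rintro rfl; exact NeZero.ne k (by simpa using h))
  have hfib := card_castHom_fiber h
  set φ := ZMod.castHom (Dvd.intro_left d h.symm) (ZMod ℓ) with hφ
  have hsurj : Function.Surjective φ := ZMod.castHom_surjective _
  set pull : Finset (ZMod ℓ) → Finset (ZMod k) := fun S' => Finset.univ.filter fun x => φ x ∈ S'
    with hpull
  have hcard : ∀ S', (pull S').card = d * S'.card := by
    intro S'
    rw [Finset.card_eq_sum_card_fiberwise (f := φ) (s := pull S') (t := S')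
      (fun x hx => by simpa [hpull] using hx)]
    rw [Finset.sum_congr rfl (g := fun _ => d), Finset.sum_const, smul_eq_mul, mul_comm]
    intro y hy
    rw [← hfib y]
    congr 1
    ext x
    simp only [hpull, Finset.mem_filter, Finset.mem_univ, true_and]
    constructor
    · exact fun hx => hx.2
    · rintro rfl
      exact ⟨hy, rfl⟩
  have hinj : Function.Injective pull := by
    intro S₁ S₂ h12
    ext y
    obtain ⟨x, rfl⟩ := hsurj y
    have := congrArg (x ∈ ·) h12
    simpa [hpull] using this
  have hinv : ∀ S', IsShiftInvariant ℓ (pull S') := by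
    intro S' x
    simp [hpull]
  have hex : ∀ S, IsShiftInvariant ℓ S → ∃ S', pull S' = S := by
    intro S hS
    refine ⟨S.image φ, ?_⟩
    ext x
    simp only [hpull, Finset.mem_filter, Finset.mem_univ, true_and, Finset.mem_image]
    constructor
    · rintro ⟨y, hy, hyx⟩
      have h1 : φ (((x - y).val : ℕ) : ZMod k) = 0 := by
        rw [ZMod.natCast_zmod_val, map_sub, hyx, sub_self]
      rw [map_natCast, ZMod.natCast_eq_zero_iff] at h1
      obtain ⟨j, hj⟩ := h1
      have h2 := (hS.mul j) y
      rw [← hj, ZMod.natCast_zmod_val] at h2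
      simpa using h2.mpr hy
    · intro hx
      exact ⟨x, hx, rfl⟩
  by_cases hs : d ∣ s
  · obtain ⟨m, rfl⟩ := hs
    rw [invariantChoose_mul hd0]
    have e : (Finset.univ.filter fun S : Finset (ZMod k) =>
        S.card = d * m ∧ IsShiftInvariant ℓ S) =
        (Finset.powersetCard m (Finset.univ : Finset (ZMod ℓ))).image pull := by
      ext S
      simp only [Finset.mem_filter, Finset.mem_univ, true_and, Finset.mem_image,
        Finset.mem_powersetCard, Finset.subset_univ]
      constructor
      · rintro ⟨h1, h2⟩
        obtain ⟨S', rfl⟩ := hex S h2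
        rw [hcard] at h1
        exact ⟨S', Nat.eq_of_mul_eq_mul_left hd0 h1, rfl⟩
      · rintro ⟨S', rfl, rfl⟩
        exact ⟨hcard S', hinv S'⟩
    rw [e, Finset.card_image_of_injective _ hinj, Finset.card_powersetCard, Finset.card_univ,
      ZMod.card]
  · rw [invariantChoose_of_not_dvd hs, Finset.card_eq_zero, Finset.filter_eq_empty_iff]
    rintro S - ⟨h1, h2⟩
    obtain ⟨S', rfl⟩ := hex S h2
    exact hs ⟨_, h1.symm.trans (hcard S')⟩

/-- Periods are closed under remainders, so a period not divisible by `o` would leave a smaller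
positive one. -/
theorem IsLeast.isShiftInvariant_iff_dvd {T : Type*} {k : ℕ} {x : T → Finset (ZMod k)} {o : ℕ}
    (ho : IsLeast {m : ℕ | 0 < m ∧ ∀ t, IsShiftInvariant m (x t)} o) (m : ℕ) :
    (∀ t, IsShiftInvariant m (x t)) ↔ o ∣ m := by
  constructor
  · intro hm
    rw [Nat.dvd_iff_mod_eq_zero]
    by_contra h0
    have h1 : ∀ t, IsShiftInvariant (m % o) (x t) := fun t =>
      ((ho.1.2 t).mul (m / o)).of_add (by rw [Nat.div_add_mod]; exact hm t)
    exact (ho.2 ⟨Nat.pos_of_ne_zero h0, h1⟩).not_gt (Nat.mod_lt _ ho.1.1)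
  · exact fun hd t => (ho.1.2 t).of_dvd hd

section

variable {T : Type*} [Fintype T] [DecidableEq T] {k : ℕ} [NeZero k]

open scoped Classical in
/-- The families of sets of residues with sizes satisfying `W` that are invariant under the shift
by `ℓ`. -/
noncomputable def invariantFamilies (k : ℕ) [NeZero k] (W : (T → ℕ) → Prop) (ℓ : ℕ) :
    Finset (T → Finset (ZMod k)) :=
  Finset.univ.filter fun x => W (fun t => (x t).card) ∧ ∀ t, IsShiftInvariant ℓ (x t)

open scoped Classical in
/-- The vectors of sizes of sets of residues modulo `k` that satisfy `W`. -/
noncomputable def sizeVectors (k : ℕ) (W : (T → ℕ) → Prop) : Finset (T → ℕ) :=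
  (Fintype.piFinset fun _ => Finset.range (k + 1)).filter W

theorem card_invariantFamilies (W : (T → ℕ) → Prop) {ℓ d : ℕ} (h : k = d * ℓ) :
    (invariantFamilies k W ℓ).card = ∑ s ∈ sizeVectors k W, ∏ t, invariantChoose d ℓ (s t) := by
  classical
  rw [Finset.card_eq_sum_card_fiberwise (f := fun x t => (x t).card) (t := sizeVectors k W)]
  · refine Finset.sum_congr rfl fun s hs => ?_
    rw [Finset.prod_congr rfl fun t _ => (card_isShiftInvariant h (s t)).symm,
      ← Fintype.card_piFinset]
    congr 1
    ext x
    simp only [invariantFamilies, Finset.mem_filter, Finset.mem_univ, true_and,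
      Fintype.mem_piFinset]
    constructor
    · rintro ⟨⟨-, h2⟩, rfl⟩ t
      exact ⟨rfl, h2 t⟩
    · intro hx
      obtain rfl : (fun t => (x t).card) = s := funext fun t => (hx t).1
      exact ⟨⟨(Finset.mem_filter.mp hs).2, fun t => (hx t).2⟩, rfl⟩
  · intro x hx
    have hx := (Finset.mem_filter.mp (Finset.mem_coe.mp hx)).2.1
    refine Finset.mem_coe.mpr (Finset.mem_filter.mpr ⟨?_, hx⟩)
    rw [Fintype.mem_piFinset]
    intro t
    rw [Finset.mem_range, Nat.lt_succ_iff]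
    exact (Finset.card_le_univ _).trans (ZMod.card k).le

open scoped Classical in
/-- The families of sets of residues with sizes satisfying `W` whose least positive period is
`ℓ`. -/
noncomputable def familiesOfOrder (k : ℕ) [NeZero k] (W : (T → ℕ) → Prop) (ℓ : ℕ) :
    Finset (T → Finset (ZMod k)) :=
  Finset.univ.filter fun x => W (fun t => (x t).card) ∧
    IsLeast {m : ℕ | 0 < m ∧ ∀ t, IsShiftInvariant m (x t)} ℓ

theorem card_invariantFamilies_eq_sum_divisors (W : (T → ℕ) → Prop) {ℓ : ℕ} (hℓ : 0 < ℓ) :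
    (invariantFamilies k W ℓ).card = ∑ o ∈ ℓ.divisors, (familiesOfOrder k W o).card := by
  classical
  rw [← Finset.card_biUnion]
  · congr 1
    ext x
    simp only [invariantFamilies, familiesOfOrder, Finset.mem_biUnion, Finset.mem_filter,
      Finset.mem_univ, true_and, Nat.mem_divisors]
    constructor
    · rintro ⟨h1, h2⟩
      have hne : ∃ m, 0 < m ∧ ∀ t, IsShiftInvariant m (x t) := ⟨ℓ, hℓ, h2⟩
      have hl : IsLeast {m : ℕ | 0 < m ∧ ∀ t, IsShiftInvariant m (x t)} (Nat.find hne) :=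
        ⟨Nat.find_spec hne, fun m hm => Nat.find_min' hne hm⟩
      exact ⟨Nat.find hne, ⟨(hl.isShiftInvariant_iff_dvd ℓ).mp h2, hℓ.ne'⟩, h1, hl⟩
    · rintro ⟨o, ⟨ho, -⟩, h1, h2⟩
      exact ⟨h1, (h2.isShiftInvariant_iff_dvd ℓ).mpr ho⟩
  · intro a _ b _ hab
    refine Finset.disjoint_left.mpr fun x ha hb => hab ?_
    exact (Finset.mem_filter.mp ha).2.2.unique (Finset.mem_filter.mp hb).2.2

end

/-! ### Divisibility of the number of families of given order -/

section

variable {I : Type*} [Fintype I] [DecidableEq I] {k : ℕ} [NeZero k]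

/-- Together, `hk` and `hℓ` make `a` the exact valuation of both `k` and `ℓ`, so the cofactor `d` is
prime to `p`. Strong induction on `ℓ` removes every order other than `ℓ` from the difference of the
two invariant counts. -/
theorem prime_pow_dvd_card_familiesOfOrder (W : (Bool × I → ℕ) → Prop)
    (hW : ∀ s, W s → IsBalanced s) (hswap : ∀ s, W (s ∘ rowSwap I) ↔ W s) {p a : ℕ}
    (hp : p.Prime) (ha : 0 < a) (hk : ¬ p ^ (a + 1) ∣ k) (ℓ : ℕ) (hℓ : p ^ a ∣ ℓ) (hℓk : ℓ ∣ k) :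
    p ^ (2 * a) ∣ (familiesOfOrder k W ℓ).card := by
  classical
  induction ℓ using Nat.strong_induction_on with
  | _ ℓ ih =>
  obtain ⟨A, rfl⟩ : p ∣ ℓ := (dvd_pow_self p ha.ne').trans hℓ
  obtain ⟨d, hd⟩ := hℓk
  have hk0 : 0 < k := Nat.pos_of_ne_zero (NeZero.ne k)
  have hA0 : 0 < A := Nat.pos_of_ne_zero (by rintro rfl; simp at hd; omega)
  have hpA0 : 0 < p * A := Nat.mul_pos hp.pos hA0
  have hpd : ¬ p ∣ d := by
    intro h
    apply hk
    rw [hd, pow_succ]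
    exact mul_dvd_mul hℓ h
  have key := prime_pow_dvd_sum_prod_sub hp ha hpd hℓ (sizeVectors k W)
    (fun s hs => hW s (Finset.mem_filter.mp hs).2) (by
      intro s
      simp only [sizeVectors, Finset.mem_filter, hswap, Fintype.mem_piFinset]
      refine and_congr_left fun _ => ?_
      exact (rowSwap I).forall_congr_left.trans (forall_congr' fun t => by simp))
  have c1 := card_invariantFamilies (k := k) W (ℓ := p * A) (d := d) (by rw [hd, mul_comm])
  have c2 := card_invariantFamilies (k := k) W (ℓ := A) (d := p * d) (by rw [hd]; ring)
  have e : (∑ o ∈ (p * A).divisors \ A.divisors, ((familiesOfOrder k W o).card : ℤ)) =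
      ∑ s ∈ sizeVectors k W, ∏ t, (invariantChoose d (p * A) (s t) : ℤ) -
      ∑ s ∈ sizeVectors k W, ∏ t, (invariantChoose (p * d) A (s t) : ℤ) := by
    rw [card_invariantFamilies_eq_sum_divisors W hpA0] at c1
    rw [card_invariantFamilies_eq_sum_divisors W hA0] at c2
    rw [eq_sub_iff_add_eq]
    have hsub : A.divisors ⊆ (p * A).divisors :=
      Nat.divisors_subset_of_dvd hpA0.ne' (Dvd.intro_left p rfl)
    have h3 := Finset.sum_sdiff (f := fun o => (familiesOfOrder k W o).card) hsub
    rw [c1, c2] at h3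
    rw [← Finset.sum_sdiff hsub, c2] at c1
    exact_mod_cast c1
  rw [← e] at key
  have hmem : p * A ∈ (p * A).divisors \ A.divisors := by
    simp only [Finset.mem_sdiff, Nat.mem_divisors, dvd_refl, true_and, hpA0.ne', ne_eq,
      not_false_eq_true, not_and, hA0.ne', not_true_eq_false, imp_false]
    intro h
    have := Nat.le_of_dvd hA0 h
    nlinarith [hp.two_le]
  rw [← Finset.add_sum_erase _ _ hmem] at key
  have hrest : ((p : ℤ) ^ (2 * a)) ∣ ∑ o ∈ ((p * A).divisors \ A.divisors).erase (p * A),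
      ((familiesOfOrder k W o).card : ℤ) := by
    refine Finset.dvd_sum fun o ho => ?_
    simp only [Finset.mem_erase, Finset.mem_sdiff, Nat.mem_divisors] at ho
    obtain ⟨hne, ⟨hdvd, -⟩, hnd⟩ := ho
    have hnd : ¬ o ∣ A := fun h => hnd ⟨h, hA0.ne'⟩
    obtain ⟨c, hc⟩ := hdvd
    -- As `o * c = p * A` and `o ∤ A`, the cofactor `c` is prime to `p`, so all of `p ^ a` lies in
    -- `o`.
    have hpc : ¬ p ∣ c := by
      rintro ⟨j, rfl⟩
      apply hnd
      refine ⟨j, Nat.eq_of_mul_eq_mul_left hp.pos ?_⟩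
      rw [hc]; ring
    have hpo : p ^ a ∣ o :=
      (Nat.Coprime.pow_left a ((Nat.Prime.coprime_iff_not_dvd hp).mpr hpc)).dvd_of_dvd_mul_right
        (hc ▸ hℓ)
    have hlt : o < p * A := lt_of_le_of_ne (Nat.le_of_dvd hpA0 ⟨c, hc⟩) hne
    exact_mod_cast ih o hlt hpo ((Dvd.intro c hc.symm).trans (Dvd.intro d hd.symm))
  exact_mod_cast (dvd_add_left hrest).mp key

/-- The number of families of full order `k` is divisible by `k ^ 2`. -/
theorem sq_dvd_card_familiesOfOrder (W : (Bool × I → ℕ) → Prop)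
    (hW : ∀ s, W s → IsBalanced s) (hswap : ∀ s, W (s ∘ rowSwap I) ↔ W s) :
    k ^ 2 ∣ (familiesOfOrder k W k).card := by
  rw [Nat.dvd_iff_prime_pow_dvd_dvd]
  intro p j hp hj
  obtain ⟨a, u, hu, e⟩ := Nat.exists_eq_pow_mul_and_not_dvd (NeZero.ne k) p hp.ne_one
  have hja : p ^ j ∣ p ^ (2 * a) := by
    have hc : Nat.Coprime (p ^ j) (u ^ 2) :=
      Nat.Coprime.pow j 2 ((Nat.Prime.coprime_iff_not_dvd hp).mpr hu)
    apply hc.dvd_of_dvd_mul_right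
    rw [mul_comm 2 a, pow_mul, ← mul_pow, ← e]
    exact hj
  refine hja.trans ?_
  rcases Nat.eq_zero_or_pos a with rfl | ha
  · simp
  · refine prime_pow_dvd_card_familiesOfOrder W hW hswap hp ha ?_ k (e ▸ Dvd.intro u rfl) dvd_rfl
    rw [e, pow_succ]
    exact fun h => hu (Nat.dvd_of_mul_dvd_mul_left (pow_pos hp.pos a) h)

end

/-! ### From Frobenius symbols to families of color sets -/

namespace GenFrob

variable {k : ℕ}

theorem eq_of_pairwise_gt_of_mem_iff {row₁ row₂ : List (ColoredPart k)}
    (h₁ : row₁.Pairwise (· > ·)) (h₂ : row₂.Pairwise (· > ·)) (h : ∀ e, e ∈ row₁ ↔ e ∈ row₂) :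
    row₁ = row₂ := by
  refine List.Perm.eq_of_pairwise (le := (· > ·)) ?_ h₁ h₂ ?_
  · intro a b _ _ hab hba
    exact absurd hab hba.not_gt
  · exact (List.perm_ext_iff_of_nodup (h₁.imp ne_of_gt) (h₂.imp ne_of_gt)).mpr h

/-- The row of a symbol, `true` for the top row. -/
def Symbol.row (s : Symbol k) (b : Bool) : List (ColoredPart k) :=
  bif b then s.top else s.bottom

theorem Symbol.row_pairwise (s : Symbol k) (b : Bool) : (s.row b).Pairwise (· > ·) := by
  cases b
  · exact s.bottom_decreasing
  · exact s.top_decreasing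

theorem Symbol.size_le_weight (s : Symbol k) (b : Bool) {e : ColoredPart k}
    (he : e ∈ s.row b) : e.size ≤ s.weight := by
  have h := List.le_sum_of_mem (List.mem_map_of_mem (f := ColoredPart.size) he)
  cases b
  · change _ ≤ (s.bottom.map ColoredPart.size).sum at h
    rw [Symbol.weight]; omega
  · change _ ≤ (s.top.map ColoredPart.size).sum at h
    rw [Symbol.weight]; omega

variable [NeZero k]

/-- The colored part of size `z` whose color corresponds to the residue `c`. -/
def residuePart (z : ℕ) (c : ZMod k) : ColoredPart k := toLex (z, (ZMod.finEquiv k).symm c)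

@[simp]
theorem residuePart_inj {z z' : ℕ} {c c' : ZMod k} :
    residuePart z c = residuePart z' c' ↔ z = z' ∧ c = c' := by
  simp [residuePart]

@[simp]
theorem size_residuePart (z : ℕ) (c : ZMod k) : (residuePart z c).size = z := rfl

theorem exists_residuePart_eq (e : ColoredPart k) : ∃ z c, residuePart z c = e :=
  ⟨(ofLex e).1, ZMod.finEquiv k (ofLex e).2, by simp [residuePart]⟩

theorem shift_residuePart (ℓ z : ℕ) (c : ZMod k) :
    ColoredPart.shift ℓ (residuePart z c) = residuePart z (c + (ℓ : ZMod k)) := by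
  have h : ∀ j : ℕ, (finRotate k ^ j) ((ZMod.finEquiv k).symm c) =
      (ZMod.finEquiv k).symm (c + (j : ZMod k)) := by
    intro j
    induction j with
    | zero => simp
    | succ j ih =>
      rw [pow_succ', Equiv.Perm.mul_apply, ih, finRotate_apply, Nat.cast_succ, ← add_assoc,
        map_add (ZMod.finEquiv k).symm (c + j) 1, map_one]
  change toLex (z, (finRotate k ^ ℓ) ((ZMod.finEquiv k).symm c)) = _
  rw [h]
  rfl

open scoped Classical in
/-- The colors of the entries of size `z` in a row, as residues. -/
noncomputable def colorsOfSize (row : List (ColoredPart k)) (z : ℕ) : Finset (ZMod k) :=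
  Finset.univ.filter fun c => residuePart z c ∈ row

theorem mem_colorsOfSize {row : List (ColoredPart k)} {z : ℕ} {c : ZMod k} :
    c ∈ colorsOfSize row z ↔ residuePart z c ∈ row := by
  simp [colorsOfSize]

theorem shift_bijective (ℓ : ℕ) :
    Function.Bijective (ColoredPart.shift ℓ : ColoredPart k → ColoredPart k) := by
  constructor
  · intro e e' h
    obtain ⟨z, c, rfl⟩ := exists_residuePart_eq e
    obtain ⟨z', c', rfl⟩ := exists_residuePart_eq e'
    simpa [shift_residuePart] using h
  · intro e
    obtain ⟨z, c, rfl⟩ := exists_residuePart_eq e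
    exact ⟨residuePart z (c - (ℓ : ZMod k)), by rw [shift_residuePart, sub_add_cancel]⟩

/-- A strictly decreasing row is determined by its set of entries, so sorting plays no role in being
fixed. -/
theorem shiftRow_eq_self_iff {row : List (ColoredPart k)} (h : row.Pairwise (· > ·)) (ℓ : ℕ) :
    shiftRow ℓ row = row ↔ ∀ z, IsShiftInvariant ℓ (colorsOfSize row z) := by
  have hmem : (∀ z, IsShiftInvariant ℓ (colorsOfSize row z)) ↔
      ∀ e, ColoredPart.shift ℓ e ∈ row ↔ e ∈ row := by
    simp only [IsShiftInvariant, mem_colorsOfSize, ← shift_residuePart]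
    constructor
    · intro hz e
      obtain ⟨z, c, rfl⟩ := exists_residuePart_eq e
      exact hz z c
    · exact fun he z c => he _
  rw [hmem]
  constructor
  · intro hs e
    conv_lhs => rw [← hs]
    rw [shiftRow, List.mem_insertionSort, List.mem_map_of_injective (shift_bijective ℓ).1]
  · intro he
    have hperm : (row.map (ColoredPart.shift ℓ)).Perm row := by
      rw [List.perm_ext_iff_of_nodup]
      · intro e
        obtain ⟨e, rfl⟩ := (shift_bijective ℓ).2 e
        rw [List.mem_map_of_injective (shift_bijective ℓ).1, he]
      · exact List.Nodup.map (shift_bijective ℓ).1 (h.imp ne_of_gt)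
      · exact h.imp ne_of_gt
    refine List.Perm.eq_of_pairwise (le := (· ≥ ·)) (fun a b _ _ h1 h2 => le_antisymm h2 h1)
      (List.pairwise_insertionSort _ _) (h.imp le_of_lt) ?_
    exact (List.perm_insertionSort _ _).trans hperm

theorem sum_map_size {row : List (ColoredPart k)} (h : row.Pairwise (· > ·)) {n : ℕ}
    (hn : ∀ e ∈ row, e.size ≤ n) (g : ℕ → ℕ) :
    (row.map fun e => g e.size).sum =
      ∑ i : Fin (n + 1), g i * (colorsOfSize row i).card := by
  rw [← List.sum_toFinset _ (h.imp ne_of_gt : row.Nodup),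
    ← Finset.sum_fiberwise_of_maps_to (g := ColoredPart.size) (t := Finset.range (n + 1)),
    Finset.sum_range]
  · refine Finset.sum_congr rfl fun i _ => ?_
    rw [Finset.sum_congr rfl (g := fun _ => g i), Finset.sum_const, smul_eq_mul, mul_comm]
    · congr 1
      symm
      refine Finset.card_nbij (residuePart (i : ℕ)) ?_ ?_ ?_
      · intro c hc
        simpa [mem_colorsOfSize] using hc
      · intro c _ c' _ hcc
        exact (residuePart_inj.mp hcc).2
      · intro e he
        obtain ⟨z, c, rfl⟩ := exists_residuePart_eq e
        simp only [Finset.coe_filter, List.mem_toFinset, size_residuePart, Set.mem_ofPred_eq] at he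
        obtain ⟨he, rfl⟩ := he
        exact ⟨c, mem_colorsOfSize.mpr he, rfl⟩
    · intro e he
      rw [(Finset.mem_filter.mp he).2]
  · intro e he
    rw [Finset.mem_range, Nat.lt_succ_iff]
    exact hn e (List.mem_toFinset.mp he)

/-- The strictly decreasing row with prescribed sets of colors for the entries of each size. -/
noncomputable def rowOfColors {n : ℕ} (x : Fin (n + 1) → Finset (ZMod k)) :
    List (ColoredPart k) :=
  ((Finset.univ.sigma x).image fun q => residuePart (q.1 : ℕ) q.2).sort (· ≥ ·)

theorem rowOfColors_pairwise {n : ℕ} (x : Fin (n + 1) → Finset (ZMod k)) :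
    (rowOfColors x).Pairwise (· > ·) :=
  (Finset.sortedGT_sort _).pairwise

theorem mem_rowOfColors {n : ℕ} {x : Fin (n + 1) → Finset (ZMod k)}
    {e : ColoredPart k} :
    e ∈ rowOfColors x ↔ ∃ i : Fin (n + 1), ∃ c ∈ x i, residuePart (i : ℕ) c = e := by
  rw [rowOfColors, Finset.mem_sort]
  simp

theorem size_le_of_mem_rowOfColors {n : ℕ} {x : Fin (n + 1) → Finset (ZMod k)}
    {e : ColoredPart k} (he : e ∈ rowOfColors x) : e.size ≤ n := by
  obtain ⟨i, c, -, rfl⟩ := mem_rowOfColors.mp he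
  exact Nat.lt_succ_iff.mp i.2

theorem colorsOfSize_rowOfColors {n : ℕ} (x : Fin (n + 1) → Finset (ZMod k))
    (i : Fin (n + 1)) : colorsOfSize (rowOfColors x) i = x i := by
  ext c
  simp [mem_colorsOfSize, mem_rowOfColors, Fin.val_inj]

/-- The sets of colors in all layers of a symbol. -/
noncomputable def Symbol.layers (n : ℕ) (s : Symbol k) (t : Bool × Fin (n + 1)) :
    Finset (ZMod k) :=
  colorsOfSize (s.row t.1) t.2

/-- The size vectors of the symbols of `n`. -/
def IsWeightVector (n : ℕ) (s : Bool × Fin (n + 1) → ℕ) : Prop :=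
  IsBalanced s ∧ ∑ i, s (true, i) + ∑ i : Fin (n + 1), (i : ℕ) * s (true, i) +
    ∑ i : Fin (n + 1), (i : ℕ) * s (false, i) = n

theorem isWeightVector_rowSwap {n : ℕ} (s : Bool × Fin (n + 1) → ℕ) :
    IsWeightVector n (s ∘ rowSwap (Fin (n + 1))) ↔ IsWeightVector n s := by
  have h1 : ∀ i, (s ∘ rowSwap (Fin (n + 1))) (true, i) = s (false, i) := fun _ => rfl
  have h2 : ∀ i, (s ∘ rowSwap (Fin (n + 1))) (false, i) = s (true, i) := fun _ => rfl
  simp only [IsWeightVector, IsBalanced, h1, h2]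
  omega

section

variable {n : ℕ} {s : Symbol k} (hs : ∀ b, ∀ e ∈ s.row b, e.size ≤ n)

include hs

theorem Symbol.isWeightVector_iff :
    IsWeightVector n (fun t => (s.layers n t).card) ↔ s.weight = n := by
  have hl : ∀ b, (s.row b).length = ∑ i : Fin (n + 1), (s.layers n (b, i)).card := by
    intro b
    have := sum_map_size (s.row_pairwise b) (hs b) fun _ => 1
    simpa [Symbol.layers] using this
  have hz : ∀ b, ((s.row b).map ColoredPart.size).sum =
      ∑ i : Fin (n + 1), (i : ℕ) * (s.layers n (b, i)).card :=
    fun b => sum_map_size (s.row_pairwise b) (hs b) id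
  have h1 := hl true
  have h2 := hl false
  have h3 := hz true
  have h4 := hz false
  have h5 := s.length_eq
  simp only [Symbol.row, cond_true, cond_false] at h1 h2 h3 h4
  simp only [IsWeightVector, IsBalanced, Symbol.weight]
  omega

theorem Symbol.isFixedByShift_iff (ℓ : ℕ) :
    s.IsFixedByShift ℓ ↔ ∀ t, IsShiftInvariant ℓ (s.layers n t) := by
  have hrow : ∀ b, shiftRow ℓ (s.row b) = s.row b ↔
      ∀ i : Fin (n + 1), IsShiftInvariant ℓ (s.layers n (b, i)) := by
    intro b
    rw [shiftRow_eq_self_iff (s.row_pairwise b)]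
    refine ⟨fun h i => h i, fun h z => ?_⟩
    by_cases hz : z < n + 1
    · exact h ⟨z, hz⟩
    -- Layers beyond `n` are empty, hence trivially invariant.
    · have : ∀ c, c ∉ colorsOfSize (s.row b) z := by
        intro c hc
        have := hs b _ (mem_colorsOfSize.mp hc)
        exact hz (Nat.lt_succ_iff.mpr this)
      intro c
      exact iff_of_false (this _) (this _)
  have h1 := hrow true
  have h2 := hrow false
  rw [Prod.forall, Bool.forall_bool, ← h1, ← h2, and_comm]
  rfl

end

/-- The part sizes of a symbol of `n` are at most `n`, so the finitely many layers `0, …, n` lose no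
information. -/
theorem bijOn_layers (n ℓ : ℕ) :
    Set.BijOn (Symbol.layers n) (symbolsOfOrder k ℓ n)
      (familiesOfOrder k (IsWeightVector n) ℓ) := by
  have horder : ∀ s : Symbol k, (∀ b, ∀ e ∈ s.row b, e.size ≤ n) →
      (s ∈ symbolsOfOrder k ℓ n ↔
        s.layers n ∈ familiesOfOrder k (IsWeightVector n) ℓ) := by
    intro s hs
    simp only [symbolsOfOrder, Set.mem_ofPred_eq, familiesOfOrder, Finset.mem_filter,
      Finset.mem_univ, true_and, Symbol.HasOrder, Symbol.isWeightVector_iff hs,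
      Symbol.isFixedByShift_iff hs]
  have hle : ∀ s ∈ symbolsOfOrder k ℓ n, ∀ b, ∀ e ∈ s.row b, e.size ≤ n := by
    intro s hs b e he
    exact hs.1 ▸ s.size_le_weight b he
  refine ⟨fun s hs => (horder s (hle s hs)).mp hs, ?_, ?_⟩
  · intro s hs s' hs' h
    have hrow : ∀ b, s.row b = s'.row b := by
      intro b
      refine eq_of_pairwise_gt_of_mem_iff (s.row_pairwise b) (s'.row_pairwise b) ?_
      intro e
      obtain ⟨z, c, rfl⟩ := exists_residuePart_eq e
      by_cases hz : z < n + 1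
      · have := congrFun h (b, ⟨z, hz⟩)
        have hc := Finset.ext_iff.mp this c
        exact mem_colorsOfSize.symm.trans (hc.trans mem_colorsOfSize)
      · exact iff_of_false (fun he => hz (Nat.lt_succ_iff.mpr (hle s hs b _ he)))
          fun he => hz (Nat.lt_succ_iff.mpr (hle s' hs' b _ he))
    exact Symbol.ext (hrow true) (hrow false)
  · intro x hx
    have hlen : ∀ b, (rowOfColors fun i => x (b, i)).length = ∑ i, (x (b, i)).card := by
      intro b
      have := sum_map_size (rowOfColors_pairwise fun i => x (b, i))
        (fun _ => size_le_of_mem_rowOfColors) fun _ => 1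
      simpa [colorsOfSize_rowOfColors] using this
    classical
    have hW : IsWeightVector n fun t => (x t).card := (Finset.mem_filter.mp hx).2.1
    let s : Symbol k :=
      { top := rowOfColors fun i => x (true, i)
        bottom := rowOfColors fun i => x (false, i)
        length_eq := by rw [hlen, hlen]; exact hW.1
        top_decreasing := rowOfColors_pairwise _
        bottom_decreasing := rowOfColors_pairwise _ }
    have hrow : ∀ b, s.row b = rowOfColors fun i => x (b, i) := by
      intro b; cases b <;> rfl
    have hlayers : s.layers n = x := by
      funext ⟨b, i⟩
      rw [Symbol.layers, hrow]
      exact colorsOfSize_rowOfColors (fun i => x (b, i)) i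
    refine ⟨s, (horder s ?_).mpr (hlayers ▸ hx), hlayers⟩
    intro b e he
    rw [hrow] at he
    exact size_le_of_mem_rowOfColors he

end GenFrob

theorem theorem7p4 (k n : ℕ) (hk : 0 < k) (hn : 0 < n) :
    (GenFrob.symbolsOfOrder k k n).Finite ∧
      k ^ 2 ∣ (GenFrob.symbolsOfOrder k k n).ncard := by
  have : NeZero k := ⟨hk.ne'⟩
  have hb := GenFrob.bijOn_layers (k := k) n k
  refine ⟨hb.finite_iff_finite.mpr (Finset.finite_toSet _), ?_⟩
  rw [hb.ncard_eq, Set.ncard_coe_finset]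
  exact sq_dvd_card_familiesOfOrder _ (fun s hs => hs.1) GenFrob.isWeightVector_rowSwap
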